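/- Let $1<p<\infty$ and let $X$ be a (real or complex) Banach space. Suppose that there is a sequence of compact operators $K_n\colon X\to X$ satisfying (a) $K_nx\to x$ in norm for all $x\in X$, (b) $K_n^*x^*\to x^*$ in norm for all $x^*\in X^*$, (c) $\|\mathrm{Id}_X-2K_n\|\to 1$. Suppose moreover that $$\limsup_{n\to\infty}\bigl(\|x\|^{p}+\|x_n\|^{p}\bigr)^{1/p}\le\limsup_{n\to\infty}\Bigl(\frac{\|x+x_n\|^{p}+\|x-x_n\|^{p}}{2}\Bigr)^{1/p}$$ for every $x\in X$ and every sequence $(x_n)$ in $X$ with $x_n\to 0$ weakly. Then the space $K(X,\ell_p)$ of compact operators is an $M$-ideal in the space $L(X,\ell_p)$ of bounded linear operators (with the operator norm), where $\ell_p$ is the space of $p$-summable sequences over the same scalar field. Here a closed subspace $J$ of a Banach space $E$ is called an $M$-ideal in $E$ if there is a closed subspace $V$ of $E^*$ such that $E^*=J^\perp\oplus_1 V$, where $J^\perp=\{f\in E^*: f|_J=0\}$; that is, $E^*$ is the direct sum of $J^\perp$ and $V$, and $\|f+g\|=\|f\|+\|g\|$ for all $f\in J^\perp$, $g\in V$.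 -/

import Mathlib

open Filter Topology
open scoped ENNReal

/-- The annihilator `J^⊥ = {f ∈ E* : f = 0 on J}` of a subspace `J` of a normed space `E`,
as a subspace of the (topological) dual `E*`. -/
def topAnnihilator {𝕜 E : Type*} [RCLike 𝕜] [NormedAddCommGroup E] [NormedSpace 𝕜 E]
    (J : Submodule 𝕜 E) : Submodule 𝕜 (StrongDual 𝕜 E) where
  carrier := {f | ∀ x ∈ J, f x = 0}
  add_mem' := by
    intro f g hf hg x hx
    simp [hf x hx, hg x hx]
  zero_mem' := by
    intro x _
    simp
  smul_mem' := by
    intro c f hf x hx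
    simp [hf x hx]

/-- `J` is an `M`-ideal in `E`: `J` is a closed subspace and there is a closed subspace `V` of the
dual with `E* = J^⊥ ⊕₁ V`, i.e. `E*` is the direct sum of `J^⊥` and `V`, and the norm is additive
on this decomposition. -/
def IsMIdeal {𝕜 E : Type*} [RCLike 𝕜] [NormedAddCommGroup E] [NormedSpace 𝕜 E]
    (J : Submodule 𝕜 E) : Prop :=
  IsClosed (J : Set E) ∧
    ∃ V : Submodule 𝕜 (StrongDual 𝕜 E),
      IsClosed (V : Set (StrongDual 𝕜 E)) ∧
      IsCompl (topAnnihilator J) V ∧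
      ∀ f ∈ topAnnihilator J, ∀ g ∈ V, ‖f + g‖ = ‖f‖ + ‖g‖

/-! The complement `V` of `J^⊥` consists of the functionals with `h T = lim_U h (T ∘ K n)`. For any
`f`, the limit of `f (T ∘ K n)` lies in `V` and agrees with `f` on compact operators, because `S ∘ K
n → S` for compact `S` (`isCompl_topAnnihilator_recoveredFunctionals`). For additivity, contractions
`S`, `T` are glued into `P_k T K_n + (1 - P_k) S (1 - K_m)`, with `P_k` the truncations of `ℓ_p`. In
the limit, `g ∈ J^⊥` sees only `S` and `h ∈ V` only `T`. Disjoint supports in `ℓ_p` bound the glued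
norm through `‖K n x‖^p + ‖x - K m x‖^p`. By `eventually_rpow_add_rpow_le` this sum is
asymptotically at most 1: the vectors `x - K m x` are weakly null, and `K n ± (1 - K m)` are almost
contractions. -/

/-! ### Bounded sequences, compact operators and norms of functionals. -/

section Sequences

variable {𝕜 X Y : Type*} [RCLike 𝕜] [NormedAddCommGroup X] [NormedSpace 𝕜 X]
  [NormedAddCommGroup Y] [NormedSpace 𝕜 Y]

/-- A sequence of operators tends to zero in norm as soon as it does so along every sequence in the
unit ball. -/
theorem tendsto_opNorm_zero_of_forall_seq {A : ℕ → X →L[𝕜] Y}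
    (h : ∀ x : ℕ → X, (∀ n, ‖x n‖ ≤ 1) → Tendsto (fun n => A n (x n)) atTop (𝓝 0)) :
    Tendsto (fun n => ‖A n‖) atTop (𝓝 0) := by
  have hx : ∀ n, ∃ x : X, ‖x‖ ≤ 1 ∧ ‖A n‖ ≤ 2 * ‖A n x‖ := by
    intro n
    rcases (norm_nonneg (A n)).eq_or_lt with h0 | h0
    · exact ⟨0, by simp, by simp [← h0]⟩
    · obtain ⟨x, hx, hAx⟩ := (A n).exists_lt_apply_of_lt_opNorm (half_lt_self h0)
      exact ⟨x, hx.le, by linarith⟩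
  choose x hx1 hx2 using hx
  refine squeeze_zero (fun n => norm_nonneg _) hx2 ?_
  simpa using (h x hx1).norm.const_mul 2

/-- A compact operator maps bounded sequences to sequences with convergent subsequences. -/
theorem IsCompactOperator.exists_tendsto_subseq {S : X →L[𝕜] Y} (hS : IsCompactOperator S)
    {x : ℕ → X} {C : ℝ} (hx : ∀ n, ‖x n‖ ≤ C) :
    ∃ z, ∃ φ : ℕ → ℕ, StrictMono φ ∧ Tendsto (fun n => S (x (φ n))) atTop (𝓝 z) := by
  have hS' : IsCompactOperator (S : X →ₗ[𝕜] Y) := hS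
  obtain ⟨z, -, φ, hφ, hz⟩ := (hS'.isCompact_closure_image_closedBall C).tendsto_subseq
    (x := fun n => S (x n)) fun n => subset_closure ⟨x n, by simpa using hx n, rfl⟩
  exact ⟨z, φ, hφ, hz⟩

/-- A compact operator maps bounded weakly null sequences to norm null sequences. -/
theorem IsCompactOperator.tendsto_zero_of_weaklyNull {S : X →L[𝕜] Y} (hS : IsCompactOperator S)
    {u : ℕ → X} {C : ℝ} (hC : ∀ n, ‖u n‖ ≤ C)
    (hu : ∀ f : StrongDual 𝕜 X, Tendsto (fun n => f (u n)) atTop (𝓝 0)) :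
    Tendsto (fun n => S (u n)) atTop (𝓝 0) := by
  refine tendsto_of_subseq_tendsto fun ns hns => ?_
  obtain ⟨z, φ, hφ, hz⟩ := hS.exists_tendsto_subseq (x := fun n => u (ns n)) fun n => hC _
  have hz0 : z = 0 := by
    rw [SeparatingDual.eq_zero_iff_forall_dual_eq_zero (R := 𝕜)]
    intro f
    exact tendsto_nhds_unique ((f.continuous.tendsto z).comp hz)
      ((hu (f.comp S)).comp (hns.comp hφ.tendsto_atTop))
  exact ⟨φ, hz0 ▸ hz⟩

theorem tendsto_toWeakSpace_zero {u : ℕ → X}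
    (hu : ∀ f : StrongDual 𝕜 X, Tendsto (fun n => f (u n)) atTop (𝓝 0)) :
    Tendsto (fun n => toWeakSpace 𝕜 X (u n)) atTop (𝓝 0) := by
  have hinj : Function.Injective (topDualPairing 𝕜 X).flip := by
    rw [injective_iff_map_eq_zero]
    intro x hx
    rw [SeparatingDual.eq_zero_iff_forall_dual_eq_zero (R := 𝕜)]
    intro f
    exact LinearMap.congr_fun hx f
  refine (WeakBilin.tendsto_iff_forall_eval_tendsto (topDualPairing 𝕜 X).flip hinj).2 fun f => ?_
  have h0 : (topDualPairing 𝕜 X).flip 0 f = 0 := by simp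
  exact (hu f).trans (h0 ▸ le_rfl)

theorem opNorm_le_of_forall_re_le {φ : StrongDual 𝕜 X} {M : ℝ}
    (h : ∀ x, ‖x‖ ≤ 1 → RCLike.re (φ x) ≤ M) : ‖φ‖ ≤ M := by
  have hM : 0 ≤ M := by simpa using h 0 (by simp)
  by_contra! hlt
  obtain ⟨x, hx, hφx⟩ := φ.exists_lt_apply_of_lt_opNorm hlt
  obtain ⟨c, hc, hcx⟩ := RCLike.exists_norm_eq_mul_self (φ x)
  have := h (c • x) (by rw [norm_smul, hc, one_mul]; exact hx.le)
  rw [map_smul, smul_eq_mul, ← hcx, RCLike.ofReal_re] at this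
  linarith

end Sequences

/-! ### Splitting the unit ball of `X` along the `K n`. -/

section ShrinkingApproximation

variable {𝕜 X Y : Type*} [RCLike 𝕜] [NormedAddCommGroup X] [NormedSpace 𝕜 X]
  [NormedAddCommGroup Y] [NormedSpace 𝕜 Y] {K : ℕ → X →L[𝕜] X}

theorem exists_norm_le_of_tendsto_norm_id_sub_two_smul
    (hc : Tendsto (fun n => ‖ContinuousLinearMap.id 𝕜 X - (2 : 𝕜) • K n‖) atTop (𝓝 1)) :
    ∃ C, ∀ n, ‖K n‖ ≤ C := by
  obtain ⟨B, hB⟩ := hc.bddAbove_range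
  refine ⟨B + 1, fun n => ?_⟩
  have h1 : ‖ContinuousLinearMap.id 𝕜 X - (2 : 𝕜) • K n‖ ≤ B := hB ⟨n, rfl⟩
  have h2 : ‖(2 : 𝕜) • K n‖ ≤
      ‖ContinuousLinearMap.id 𝕜 X‖ + ‖ContinuousLinearMap.id 𝕜 X - (2 : 𝕜) • K n‖ := by
    simpa using norm_sub_le (ContinuousLinearMap.id 𝕜 X)
      (ContinuousLinearMap.id 𝕜 X - (2 : 𝕜) • K n)
  rw [norm_smul, RCLike.norm_ofNat] at h2
  have h3 := ContinuousLinearMap.norm_id_le (𝕜 := 𝕜) (E := X)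
  have h4 := norm_nonneg (K n)
  linarith

theorem tendsto_apply_sub_of_adjoint_tendsto
    (hb : ∀ f : StrongDual 𝕜 X, Tendsto (fun n => f.comp (K n)) atTop (𝓝 f))
    {φ : ℕ → ℕ} (hφ : Tendsto φ atTop atTop) {x : ℕ → X} (hx : ∀ n, ‖x n‖ ≤ 1)
    (f : StrongDual 𝕜 X) :
    Tendsto (fun n => f (x n - K (φ n) (x n))) atTop (𝓝 0) := by
  have h := (tendsto_iff_norm_sub_tendsto_zero.1 (hb f)).comp hφ
  refine squeeze_zero_norm (fun n => ?_) h
  calc ‖f (x n - K (φ n) (x n))‖ = ‖(f.comp (K (φ n)) - f) (x n)‖ := by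
        rw [← norm_neg]; simp
    _ ≤ ‖f.comp (K (φ n)) - f‖ := ContinuousLinearMap.unit_le_opNorm _ _ (hx n)

theorem norm_apply_sub_le {C : ℝ} (hC : ∀ n, ‖K n‖ ≤ C) (n : ℕ) {x : X} (hx : ‖x‖ ≤ 1) :
    ‖x - K n x‖ ≤ 1 + C :=
  (norm_sub_le _ _).trans
    (add_le_add hx (((K n).unit_le_opNorm x hx).trans (hC n)))

/-- By `hb`, the operators `1 - K n` turn sequences in the unit ball into bounded weakly null ones,
which `S` makes norm null. -/
theorem IsCompactOperator.tendsto_norm_comp_id_sub {C : ℝ} (hC : ∀ n, ‖K n‖ ≤ C)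
    (hb : ∀ f : StrongDual 𝕜 X, Tendsto (fun n => f.comp (K n)) atTop (𝓝 f))
    {S : X →L[𝕜] Y} (hS : IsCompactOperator S) :
    Tendsto (fun n => ‖S.comp (ContinuousLinearMap.id 𝕜 X - K n)‖) atTop (𝓝 0) := by
  refine tendsto_opNorm_zero_of_forall_seq fun x hx => ?_
  simpa using hS.tendsto_zero_of_weaklyNull (fun n => norm_apply_sub_le hC n (hx n))
    (tendsto_apply_sub_of_adjoint_tendsto hb tendsto_id hx)

/-- The operators `K n ± (1 - K m)` have norm at most `(1 + ‖1 - 2 K n‖) / 2`, asymptotically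
in `m`. -/
theorem eventually_norm_add_le_and_norm_sub_le
    (hK : ∀ n, IsCompactOperator (K n))
    (hb : ∀ f : StrongDual 𝕜 X, Tendsto (fun n => f.comp (K n)) atTop (𝓝 f))
    (hc : Tendsto (fun n => ‖ContinuousLinearMap.id 𝕜 X - (2 : 𝕜) • K n‖) atTop (𝓝 1))
    (n : ℕ) {c : ℝ} (hcn : (1 + ‖ContinuousLinearMap.id 𝕜 X - (2 : 𝕜) • K n‖) / 2 < c) :
    ∀ᶠ m in atTop, ‖K n + (ContinuousLinearMap.id 𝕜 X - K m)‖ ≤ c ∧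
      ‖K n - (ContinuousLinearMap.id 𝕜 X - K m)‖ ≤ c := by
  obtain ⟨C, hC⟩ := exists_norm_le_of_tendsto_norm_id_sub_two_smul hc
  set I := ContinuousLinearMap.id 𝕜 X with hI
  have h0 := (hK n).tendsto_norm_comp_id_sub hC hb
  have h1 : Tendsto (fun m => (1 + ‖I - (2 : 𝕜) • K n‖ * ‖I - (2 : 𝕜) • K m‖) / 2
      + 2 * ‖(K n).comp (I - K m)‖) atTop (𝓝 ((1 + ‖I - (2 : 𝕜) • K n‖ * 1) / 2 + 2 * 0)) :=
    (((hc.const_mul _).const_add 1).div_const 2).add (h0.const_mul 2)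
  have h2 : Tendsto (fun m => (‖I - (2 : 𝕜) • K n‖ + ‖I - (2 : 𝕜) • K m‖) / 2) atTop
      (𝓝 ((‖I - (2 : 𝕜) • K n‖ + 1) / 2)) := (hc.const_add _).div_const 2
  filter_upwards [h1.eventually_lt_const (by linarith : _ < c),
    h2.eventually_lt_const (by linarith : _ < c)] with m hm1 hm2
  constructor
  · have e : (2 : 𝕜) • (K n + (I - K m)) = I + (I - (2 : 𝕜) • K n).comp (I - (2 : 𝕜) • K m)
        + (4 : 𝕜) • (K n).comp (I - K m) := by
      ext x
      simp [hI]
      module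
    have h3 : ‖(2 : 𝕜) • (K n + (I - K m))‖ ≤
        1 + ‖I - (2 : 𝕜) • K n‖ * ‖I - (2 : 𝕜) • K m‖ + 4 * ‖(K n).comp (I - K m)‖ := by
      rw [e]
      refine (norm_add₃_le).trans (add_le_add_three ContinuousLinearMap.norm_id_le
        (ContinuousLinearMap.opNorm_comp_le _ _) ?_)
      rw [norm_smul, RCLike.norm_ofNat]
    rw [norm_smul, RCLike.norm_ofNat] at h3
    linarith
  · have e : (2 : 𝕜) • (K n - (I - K m)) = -((I - (2 : 𝕜) • K n) + (I - (2 : 𝕜) • K m)) := by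
      module
    have h3 : ‖(2 : 𝕜) • (K n - (I - K m))‖ ≤ ‖I - (2 : 𝕜) • K n‖ + ‖I - (2 : 𝕜) • K m‖ := by
      rw [e, norm_neg]
      exact norm_add_le _ _
    rw [norm_smul, RCLike.norm_ofNat] at h3
    linarith

/-- The `ℓ_p`-type inequality for weakly null sequences splits the unit ball along `K n` and
`1 - K m`, asymptotically in `m`. -/
theorem eventually_rpow_add_rpow_le {q : ℝ} (hq : 0 < q)
    (hK : ∀ n, IsCompactOperator (K n))
    (hb : ∀ f : StrongDual 𝕜 X, Tendsto (fun n => f.comp (K n)) atTop (𝓝 f))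
    (hc : Tendsto (fun n => ‖ContinuousLinearMap.id 𝕜 X - (2 : 𝕜) • K n‖) atTop (𝓝 1))
    (hineq : ∀ (x : X) (u : ℕ → X),
      Tendsto (fun n => toWeakSpace 𝕜 X (u n)) atTop (𝓝 0) →
      limsup (fun n => (‖x‖ ^ q + ‖u n‖ ^ q) ^ (1 / q)) atTop ≤
        limsup (fun n => ((‖x + u n‖ ^ q + ‖x - u n‖ ^ q) / 2) ^ (1 / q)) atTop)
    (n : ℕ) {c : ℝ} (hcn : (1 + ‖ContinuousLinearMap.id 𝕜 X - (2 : 𝕜) • K n‖) / 2 < c) :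
    ∀ᶠ m in atTop, ∀ x : X, ‖x‖ ≤ 1 → ‖K n x‖ ^ q + ‖x - K m x‖ ^ q ≤ c ^ q := by
  obtain ⟨C, hC⟩ := exists_norm_le_of_tendsto_norm_id_sub_two_smul hc
  -- `d` bounds `‖K n ± (1 - K m)‖`; the gap `d' - d` absorbs the error `‖z - K n (y j)‖`; `d' < c`
  -- gives the contradiction.
  obtain ⟨d, hd, hdc⟩ := exists_between hcn
  obtain ⟨d', hd', hdc'⟩ := exists_between hdc
  have hd0 : 0 < d := lt_of_le_of_lt (by positivity) hd
  have hc0 : 0 < c := hd0.trans hdc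
  by_contra hcon
  rw [not_eventually] at hcon
  obtain ⟨φ, hφ, hbad⟩ := extraction_of_frequently_atTop hcon
  push Not at hbad
  choose x hx hxbad using hbad
  -- Since `hineq` takes a fixed vector, `K n` of the bad vectors is replaced by its limit `z` along
  -- a subsequence.
  obtain ⟨z, ψ, hψ, hz⟩ := (hK n).exists_tendsto_subseq hx
  obtain ⟨r, -, χ, hχ, hr⟩ := tendsto_subseq_of_bounded (Metric.isBounded_Icc 0 (1 + C))
    (x := fun j => ‖x (ψ j) - K (φ (ψ j)) (x (ψ j))‖)
    fun j => ⟨norm_nonneg _, norm_apply_sub_le hC _ (hx _)⟩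
  have hz' := hz.comp hχ.tendsto_atTop
  have hθ : Tendsto (fun j => φ (ψ (χ j))) atTop atTop :=
    (hφ.comp (hψ.comp hχ)).tendsto_atTop
  set y : ℕ → X := fun j => x (ψ (χ j)) with hy
  set u : ℕ → X := fun j => y j - K (φ (ψ (χ j))) (y j) with hu
  replace hz' : Tendsto (fun j => K n (y j)) atTop (𝓝 z) := hz'
  replace hr : Tendsto (fun j => ‖u j‖) atTop (𝓝 r) := hr
  have hmain := hineq z u (tendsto_toWeakSpace_zero
    (tendsto_apply_sub_of_adjoint_tendsto hb hθ fun j => hx _))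
  have hleft : Tendsto (fun j => (‖z‖ ^ q + ‖u j‖ ^ q) ^ (1 / q)) atTop
      (𝓝 ((‖z‖ ^ q + r ^ q) ^ (1 / q))) :=
    ((hr.rpow_const (Or.inr hq.le)).const_add _).rpow_const (Or.inr (by positivity))
  rw [hleft.limsup_eq] at hmain
  have hlow : c ≤ (‖z‖ ^ q + r ^ q) ^ (1 / q) := by
    have h1 : Tendsto (fun j => ‖K n (y j)‖ ^ q + ‖u j‖ ^ q) atTop (𝓝 (‖z‖ ^ q + r ^ q)) :=
      (hz'.norm.rpow_const (Or.inr hq.le)).add (hr.rpow_const (Or.inr hq.le))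
    have h2 : c ^ q ≤ ‖z‖ ^ q + r ^ q := ge_of_tendsto' h1 fun j => (hxbad _).le
    calc c = (c ^ q) ^ (1 / q) := by rw [one_div, Real.rpow_rpow_inv hc0.le hq.ne']
      _ ≤ _ := Real.rpow_le_rpow (by positivity) h2 (by positivity)
  have hup : limsup (fun j => ((‖z + u j‖ ^ q + ‖z - u j‖ ^ q) / 2) ^ (1 / q)) atTop ≤ d' := by
    refine limsup_le_of_le (isCoboundedUnder_le_of_le _ (x := 0) fun j => by positivity) ?_
    have hdist : ∀ᶠ j in atTop, ‖z - K n (y j)‖ < d' - d := by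
      have := (tendsto_const_nhds (x := z)).sub hz'
      rw [sub_self] at this
      have h0 := this.norm
      rw [norm_zero] at h0
      exact h0.eventually_lt_const (by linarith)
    filter_upwards [hdist, hθ.eventually
      (eventually_norm_add_le_and_norm_sub_le hK hb hc n hd)] with j hj hKj
    have hp : ‖z + u j‖ ≤ d' := by
      have h1 : ‖K n (y j) + u j‖ ≤ d := by
        simpa using ((K n + (ContinuousLinearMap.id 𝕜 X - K (φ (ψ (χ j))))).unit_le_opNorm _
          (hx (ψ (χ j)))).trans hKj.1
      have h2 := norm_add_le (z - K n (y j)) (K n (y j) + u j)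
      rw [← add_assoc, sub_add_cancel] at h2
      linarith
    have hm : ‖z - u j‖ ≤ d' := by
      have h1 : ‖K n (y j) - u j‖ ≤ d := by
        simpa using ((K n - (ContinuousLinearMap.id 𝕜 X - K (φ (ψ (χ j))))).unit_le_opNorm _
          (hx (ψ (χ j)))).trans hKj.2
      have h2 := norm_add_le (z - K n (y j)) (K n (y j) - u j)
      rw [sub_add_sub_cancel] at h2
      linarith
    have hd'0 : 0 ≤ d' := (norm_nonneg _).trans hp
    calc ((‖z + u j‖ ^ q + ‖z - u j‖ ^ q) / 2) ^ (1 / q)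
        ≤ ((d' ^ q + d' ^ q) / 2) ^ (1 / q) := by gcongr
      _ = d' := by rw [add_self_div_two, one_div, Real.rpow_rpow_inv hd'0 hq.ne']
  linarith

end ShrinkingApproximation

/-! ### The complement of the annihilator. -/

section Annihilator

variable {𝕜 X Y : Type*} [RCLike 𝕜] [NormedAddCommGroup X] [NormedSpace 𝕜 X]
  [NormedAddCommGroup Y] [NormedSpace 𝕜 Y]

/-- The functionals on `L(X, Y)` that are recovered from their values on the operators
`T ∘ K n` in the limit along the ultrafilter `U`. -/
def recoveredFunctionals (Y : Type*) [NormedAddCommGroup Y] [NormedSpace 𝕜 Y]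
    (K : ℕ → X →L[𝕜] X) (U : Ultrafilter ℕ) :
    Submodule 𝕜 (StrongDual 𝕜 (X →L[𝕜] Y)) where
  carrier := {h | ∀ T : X →L[𝕜] Y, Tendsto (fun n => h (T.comp (K n))) U (𝓝 (h T))}
  add_mem' := fun hf hg T => (hf T).add (hg T)
  zero_mem' := fun _ => tendsto_const_nhds
  smul_mem' := fun c _ hf T => (hf T).const_smul c

variable {K : ℕ → X →L[𝕜] X} {U : Ultrafilter ℕ}

theorem norm_apply_comp_le {C : ℝ} (hC : ∀ n, ‖K n‖ ≤ C) (f : StrongDual 𝕜 (X →L[𝕜] Y))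
    (T : X →L[𝕜] Y) (n : ℕ) : ‖f (T.comp (K n))‖ ≤ C * ‖f‖ * ‖T‖ :=
  calc ‖f (T.comp (K n))‖ ≤ ‖f‖ * ‖T.comp (K n)‖ := f.le_opNorm _
    _ ≤ ‖f‖ * (‖T‖ * C) := by
        gcongr
        exact (T.opNorm_comp_le _).trans (by gcongr; exact hC n)
    _ = C * ‖f‖ * ‖T‖ := by ring

theorem isClosed_recoveredFunctionals {C : ℝ} (hC : ∀ n, ‖K n‖ ≤ C) :
    IsClosed (recoveredFunctionals Y K U : Set (StrongDual 𝕜 (X →L[𝕜] Y))) := by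
  have hC0 : 0 ≤ C := (norm_nonneg _).trans (hC 0)
  refine isClosed_of_closure_subset fun h hh T => ?_
  rw [Metric.tendsto_nhds]
  intro ε hε
  -- Replacing `h` by `g` costs at most `(C + 1) * ‖T‖ * ‖h - g‖`, uniformly in `n`; the `+ 1` keeps
  -- the denominator positive.
  obtain ⟨g, hg, hgh⟩ := (Metric.mem_closure_iff (α := StrongDual 𝕜 (X →L[𝕜] Y))).1 hh
    (ε / 2 / ((C + 1) * ‖T‖ + 1)) (by positivity)
  replace hgh : ‖h - g‖ < ε / 2 / ((C + 1) * ‖T‖ + 1) := (dist_eq_norm h g).symm.trans_lt hgh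
  rw [lt_div_iff₀ (by positivity)] at hgh
  filter_upwards [(Metric.tendsto_nhds.1 (hg T)) (ε / 2) (by positivity)] with n hn
  have h1 := norm_apply_comp_le hC (h - g) T n
  have h2 := (h - g).le_opNorm T
  rw [sub_apply] at h1 h2
  rw [dist_eq_norm] at hn ⊢
  have h3 : h (T.comp (K n)) - h T = (h (T.comp (K n)) - g (T.comp (K n)))
      + (g (T.comp (K n)) - g T) - (h T - g T) := by ring
  have h4 := norm_sub_le ((h (T.comp (K n)) - g (T.comp (K n))) + (g (T.comp (K n)) - g T))
    (h T - g T)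
  have h5 := norm_add_le (h (T.comp (K n)) - g (T.comp (K n))) (g (T.comp (K n)) - g T)
  rw [← h3] at h4
  have h6 := norm_nonneg (h - g)
  linarith

/-- If `S ∘ K n → S` for compact `S`, then every functional on `L(X, Y)` agrees on the compact
operators with a recovered one. -/
theorem isCompl_topAnnihilator_recoveredFunctionals {C : ℝ} (hC : ∀ n, ‖K n‖ ≤ C)
    (hK : ∀ n, IsCompactOperator (K n)) (hU : (U : Filter ℕ) ≤ atTop)
    (hS : ∀ S : X →L[𝕜] Y, IsCompactOperator S →
      Tendsto (fun n => S.comp (K n)) atTop (𝓝 S)) :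
    IsCompl (topAnnihilator (compactOperator (RingHom.id 𝕜) X Y))
      (recoveredFunctionals Y K U) := by
  have hJ : ∀ (T : X →L[𝕜] Y) n, T.comp (K n) ∈ compactOperator (RingHom.id 𝕜) X Y :=
    fun T n => (hK n).clm_comp T
  constructor
  · rw [Submodule.disjoint_def]
    intro f hf hfV
    ext T
    refine tendsto_nhds_unique (hfV T) ?_
    simp [hf _ (hJ T _)]
  · rw [codisjoint_iff, Submodule.eq_top_iff']
    intro f
    have hlim : ∀ T : X →L[𝕜] Y, ∃ a : 𝕜, Tendsto (fun n => f (T.comp (K n))) U (𝓝 a) := by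
      intro T
      obtain ⟨a, -, ha⟩ := (isCompact_closedBall (0 : 𝕜) (C * ‖f‖ * ‖T‖)).ultrafilter_le_nhds
        (U.map fun n => f (T.comp (K n))) (by
          rw [le_principal_iff]
          refine mem_map.2 (Eventually.of_forall fun n => ?_)
          exact mem_closedBall_zero_iff.2 (norm_apply_comp_le hC f T n))
      exact ⟨a, ha⟩
    choose L hL using hlim
    let P : StrongDual 𝕜 (X →L[𝕜] Y) := LinearMap.mkContinuous
      { toFun := L
        map_add' := fun S T => tendsto_nhds_unique (hL (S + T))
          (by simpa using (hL S).add (hL T))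
        map_smul' := fun c T => tendsto_nhds_unique (hL (c • T))
          (by simpa using (hL T).const_smul c) }
      (C * ‖f‖) fun T => le_of_tendsto (hL T).norm
        (Eventually.of_forall fun n => norm_apply_comp_le hC f T n)
    have hPf : ∀ S ∈ compactOperator (RingHom.id 𝕜) X Y, P S = f S := fun S h =>
      tendsto_nhds_unique (hL S) (((f.continuous.tendsto S).comp (hS S h)).mono_left hU)
    have hPV : P ∈ recoveredFunctionals Y K U := by
      intro T
      have h1 : (fun n => P (T.comp (K n))) = fun n => f (T.comp (K n)) :=
        funext fun n => hPf _ (hJ T n)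
      rw [h1]
      exact hL T
    refine Submodule.mem_sup.2 ⟨f - P, fun S h => ?_, P, hPV, sub_add_cancel f P⟩
    rw [sub_apply, hPf S h, sub_self]

end Annihilator

/-! ### Coordinate truncations of `ℓ_p`. -/

section Truncation

variable {𝕜 : Type*} [RCLike 𝕜] {p : ℝ≥0∞} [Fact (1 ≤ p)]

/-- The `i`-th coordinate functional on `ℓ_p`. -/
noncomputable def lpCoord (𝕜 : Type*) [RCLike 𝕜] (p : ℝ≥0∞) [Fact (1 ≤ p)] (i : ℕ) :
    lp (fun _ : ℕ => 𝕜) p →L[𝕜] 𝕜 :=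
  LinearMap.mkContinuous (𝕜 := 𝕜) (𝕜₂ := 𝕜) (σ := RingHom.id 𝕜)
    { toFun := fun x : lp (fun _ : ℕ => 𝕜) p => x i
      map_add' := fun _ _ => rfl
      map_smul' := fun _ _ => rfl } 1 fun x => by
        rw [one_mul]
        exact lp.norm_apply_le_norm (zero_lt_one.trans_le Fact.out).ne' x i

theorem lpCoord_apply (i : ℕ) (x : lp (fun _ : ℕ => 𝕜) p) : lpCoord 𝕜 p i x = x i := rfl

/-- The projection of `ℓ_p` onto the first `k` coordinates. -/
noncomputable def lpTruncation (𝕜 : Type*) [RCLike 𝕜] (p : ℝ≥0∞) [Fact (1 ≤ p)] (k : ℕ) :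
    lp (fun _ : ℕ => 𝕜) p →L[𝕜] lp (fun _ : ℕ => 𝕜) p :=
  ∑ i ∈ Finset.range k,
    (lp.singleContinuousLinearMap 𝕜 (fun _ : ℕ => 𝕜) p i).comp (lpCoord 𝕜 p i)

theorem lpTruncation_apply (k : ℕ) (x : lp (fun _ : ℕ => 𝕜) p) :
    lpTruncation 𝕜 p k x = ∑ i ∈ Finset.range k, lp.single p i (x i) := by
  simp [lpTruncation, lpCoord_apply]

theorem isCompactOperator_lpTruncation (k : ℕ) : IsCompactOperator (lpTruncation 𝕜 p k) := by
  have : lpTruncation 𝕜 p k ∈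
      compactOperator (RingHom.id 𝕜) (lp (fun _ : ℕ => 𝕜) p) (lp (fun _ : ℕ => 𝕜) p) := by
    refine Submodule.sum_mem _ fun i _ => ?_
    have h : IsCompactOperator (lpCoord 𝕜 p i) := isCompactOperator_of_locallyCompactSpace_dom _
    exact h.clm_comp (lp.singleContinuousLinearMap 𝕜 (fun _ : ℕ => 𝕜) p i)
  exact this

theorem tendsto_lpTruncation (hp : p ≠ ∞) (x : lp (fun _ : ℕ => 𝕜) p) :
    Tendsto (fun k => lpTruncation 𝕜 p k x) atTop (𝓝 x) := by
  simpa only [lpTruncation_apply] using (lp.hasSum_single hp x).tendsto_sum_nat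

theorem norm_sub_lpTruncation_le (hp : 0 < p.toReal) (k : ℕ) (x : lp (fun _ : ℕ => 𝕜) p) :
    ‖x - lpTruncation 𝕜 p k x‖ ≤ ‖x‖ := by
  rw [← Real.rpow_le_rpow_iff (norm_nonneg _) (norm_nonneg _) hp, lpTruncation_apply,
    lp.norm_compl_sum_single hp]
  exact sub_le_self _ (Finset.sum_nonneg fun i _ => by positivity)

/-- The two summands have disjoint supports, so their `p`-th powers add, and neither truncation
increases the norm. -/
theorem norm_lpTruncation_add_rpow_le (hp : 0 < p.toReal) (k : ℕ)
    (x y : lp (fun _ : ℕ => 𝕜) p) :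
    ‖lpTruncation 𝕜 p k x + (y - lpTruncation 𝕜 p k y)‖ ^ p.toReal ≤
      ‖x‖ ^ p.toReal + ‖y‖ ^ p.toReal := by
  set w := lpTruncation 𝕜 p k x + (y - lpTruncation 𝕜 p k y) with hw
  have happ : ∀ (v : lp (fun _ : ℕ => 𝕜) p) i, i ∈ Finset.range k →
      lpTruncation 𝕜 p k v i = v i := by
    intro v i hi
    rw [lpTruncation_apply, lp.coeFn_sum, Finset.sum_apply]
    simp only [lp.coeFn_single, Finset.sum_pi_single, hi, if_true]
  have hwi : ∀ i ∈ Finset.range k, w i = x i := by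
    intro i hi
    simp [hw, happ _ i hi]
  have hQ : w - lpTruncation 𝕜 p k w = y - lpTruncation 𝕜 p k y := by
    have : lpTruncation 𝕜 p k w = lpTruncation 𝕜 p k x := by
      rw [lpTruncation_apply, lpTruncation_apply]
      exact Finset.sum_congr rfl fun i hi => by rw [hwi i hi]
    rw [this, hw]
    abel
  have h1 := lp.norm_sub_norm_compl_sub_single hp w (Finset.range k)
  rw [← lpTruncation_apply, hQ, Finset.sum_congr rfl fun i hi => by rw [hwi i hi]] at h1
  have h2 := lp.sum_rpow_le_norm_rpow hp x (Finset.range k)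
  have h3 := Real.rpow_le_rpow (norm_nonneg _) (norm_sub_lpTruncation_le hp k y) hp.le
  linarith

variable {X : Type*} [NormedAddCommGroup X] [NormedSpace 𝕜 X]

/-- Pointwise convergence of the contractions `1 - P_k` to zero is uniform on relatively compact
sets. -/
theorem IsCompactOperator.tendsto_lpTruncation_comp (hp : 0 < p.toReal) (hp' : p ≠ ∞)
    {S : X →L[𝕜] lp (fun _ : ℕ => 𝕜) p} (hS : IsCompactOperator S) :
    Tendsto (fun k => (lpTruncation 𝕜 p k).comp S) atTop (𝓝 S) := by
  rw [tendsto_iff_norm_sub_tendsto_zero]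
  simp_rw [norm_sub_rev _ S]
  refine tendsto_opNorm_zero_of_forall_seq fun x hx => ?_
  refine tendsto_of_subseq_tendsto fun ns hns => ?_
  obtain ⟨z, φ, hφ, hz⟩ := hS.exists_tendsto_subseq (x := fun n => x (ns n)) fun n => hx _
  refine ⟨φ, ?_⟩
  have h1 : Tendsto (fun n => ‖S (x (ns (φ n))) - z‖
      + ‖z - lpTruncation 𝕜 p (ns (φ n)) z‖) atTop (𝓝 (0 + 0)) := by
    refine (tendsto_iff_norm_sub_tendsto_zero.1 hz).add ?_
    have h0 := tendsto_iff_norm_sub_tendsto_zero.1 (tendsto_lpTruncation hp' z)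
    simp_rw [norm_sub_rev _ z] at h0
    exact h0.comp (hns.comp hφ.tendsto_atTop)
  rw [add_zero] at h1
  refine squeeze_zero_norm (fun n => ?_) h1
  set v := S (x (ns (φ n)))
  have h2 := norm_add_le ((v - z) - lpTruncation 𝕜 p (ns (φ n)) (v - z))
    (z - lpTruncation 𝕜 p (ns (φ n)) z)
  have h3 : ((v - z) - lpTruncation 𝕜 p (ns (φ n)) (v - z))
    + (z - lpTruncation 𝕜 p (ns (φ n)) z) = v - lpTruncation 𝕜 p (ns (φ n)) v := by
    rw [map_sub]; abel
  rw [h3] at h2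
  exact h2.trans (by gcongr; exact norm_sub_lpTruncation_le hp _ _)

end Truncation

/-! ### Norm additivity and the theorem. -/

/-- A recovered functional and a functional vanishing on the compact operators are norm additive,
provided that the unit ball of `X` splits along `K n` and `1 - K m`. -/
theorem norm_add_norm_le_of_eventually_rpow_add_rpow_le {𝕜 X : Type*} [RCLike 𝕜]
    [NormedAddCommGroup X] [NormedSpace 𝕜 X] {p : ℝ≥0∞} [Fact (1 ≤ p)] (hp : p ≠ ∞)
    {K : ℕ → X →L[𝕜] X} (hK : ∀ n, IsCompactOperator (K n)) {U : Ultrafilter ℕ}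
    (hU : (U : Filter ℕ) ≤ atTop) {b : ℕ → ℝ} (hb : Tendsto b atTop (𝓝 1)) (hb0 : ∀ n, 0 ≤ b n)
    (hsplit : ∀ n, ∀ c > b n, ∀ᶠ m in atTop, ∀ x : X, ‖x‖ ≤ 1 →
      ‖K n x‖ ^ p.toReal + ‖x - K m x‖ ^ p.toReal ≤ c ^ p.toReal)
    {g h : StrongDual 𝕜 (X →L[𝕜] lp (fun _ : ℕ => 𝕜) p)}
    (hg : g ∈ topAnnihilator (compactOperator (RingHom.id 𝕜) X (lp (fun _ : ℕ => 𝕜) p)))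
    (hh : h ∈ recoveredFunctionals (lp (fun _ : ℕ => 𝕜) p) K U) :
    ‖g‖ + ‖h‖ ≤ ‖g + h‖ := by
  have hp0 : 0 < p.toReal := ENNReal.toReal_pos (zero_lt_one.trans_le Fact.out).ne' hp
  have key : ∀ S T : X →L[𝕜] lp (fun _ : ℕ => 𝕜) p, ‖S‖ ≤ 1 → ‖T‖ ≤ 1 →
      RCLike.re (g S) + RCLike.re (h T) ≤ ‖g + h‖ := by
    intro S T hS hT
    -- The limits are taken in the order `m` along `U`, `k → ∞`, `c ↓ b n`, `n` along `U`.
    have hk : ∀ n k, ∀ c > b n, RCLike.re (g S)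
        + RCLike.re (h ((lpTruncation 𝕜 p k).comp (T.comp (K n)))) ≤ c * ‖g + h‖ := by
      intro n k c hc
      have hc0 : 0 ≤ c := (hb0 n).trans hc.le
      set A := (lpTruncation 𝕜 p k).comp (T.comp (K n)) with hA
      set B := S - (lpTruncation 𝕜 p k).comp S with hB
      have hnorm : ∀ᶠ m in atTop, ‖A + (B - B.comp (K m))‖ ≤ c := by
        filter_upwards [hsplit n c hc] with m hm
        refine ContinuousLinearMap.opNorm_le_of_unit_norm hc0 fun x hx => ?_
        have e : (A + (B - B.comp (K m))) x = lpTruncation 𝕜 p k (T (K n x))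
            + (S (x - K m x) - lpTruncation 𝕜 p k (S (x - K m x))) := by
          simp only [hA, hB, add_apply, sub_apply,
            ContinuousLinearMap.comp_apply, map_sub]
          abel
        rw [e, ← Real.rpow_le_rpow_iff (norm_nonneg _) hc0 hp0]
        refine (norm_lpTruncation_add_rpow_le hp0 k _ _).trans (le_trans ?_ (hm x hx.le))
        gcongr
        · exact (T.le_of_opNorm_le hT _).trans_eq (one_mul _)
        · exact (S.le_of_opNorm_le hS _).trans_eq (one_mul _)
      -- `A`, `P_k S` and `B ∘ K m` are compact, hence invisible to `g`.
      have hgA : g A = 0 := hg (_ ∘L T ∘L K n) (((hK n).clm_comp T).clm_comp _)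
      have hgB : g B = g S := by
        rw [hB, map_sub, hg (_ ∘L S) ((isCompactOperator_lpTruncation k).comp_clm S), sub_zero]
      have hlim : Tendsto (fun m => RCLike.re ((g + h) (A + (B - B.comp (K m))))) U
          (𝓝 (RCLike.re (g S + (h A + (h B - h B))))) := by
        have e : ∀ m, (g + h) (A + (B - B.comp (K m))) =
            g S + (h A + (h B - h (B.comp (K m)))) := by
          intro m
          rw [add_apply, map_add g, map_sub g, hgA, hgB,
            hg (B ∘L K m) ((hK m).clm_comp B), map_add h, map_sub h]
          ring
        simp_rw [e]
        exact (RCLike.continuous_re.tendsto _).comp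
          (((tendsto_const_nhds.sub (hh B)).const_add _).const_add _)
      rw [sub_self, add_zero, map_add] at hlim
      refine le_of_tendsto hlim ?_
      filter_upwards [hnorm.filter_mono hU] with m hm
      calc RCLike.re ((g + h) (A + (B - B.comp (K m))))
          ≤ ‖(g + h) (A + (B - B.comp (K m)))‖ := RCLike.re_le_norm _
        _ ≤ ‖g + h‖ * ‖A + (B - B.comp (K m))‖ := (g + h).le_opNorm _
        _ ≤ c * ‖g + h‖ := by rw [mul_comm]; gcongr
    have hn : ∀ n, RCLike.re (g S) + RCLike.re (h (T.comp (K n))) ≤ b n * ‖g + h‖ := by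
      intro n
      have hlim : Tendsto (fun c => c * ‖g + h‖) (𝓝[>] (b n)) (𝓝 (b n * ‖g + h‖)) :=
        ((continuous_id.mul continuous_const).tendsto (b n)).mono_left nhdsWithin_le_nhds
      refine ge_of_tendsto hlim ?_
      filter_upwards [self_mem_nhdsWithin] with c hc
      have hcomp : IsCompactOperator (T.comp (K n)) := (hK n).clm_comp T
      exact le_of_tendsto' (((RCLike.continuous_re.comp h.continuous).tendsto _).comp
        (hcomp.tendsto_lpTruncation_comp hp0 hp) |>.const_add _) fun k => hk n k c hc
    have hleft : Tendsto (fun n => RCLike.re (g S) + RCLike.re (h (T.comp (K n)))) U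
        (𝓝 (RCLike.re (g S) + RCLike.re (h T))) :=
      ((RCLike.continuous_re.tendsto _).comp (hh T)).const_add _
    have hright : Tendsto (fun n => b n * ‖g + h‖) U (𝓝 (1 * ‖g + h‖)) :=
      (hb.mono_left hU).mul_const _
    simpa using le_of_tendsto_of_tendsto' hleft hright hn
  -- As `S` and `T` vary independently in `key`, the two suprema can be taken one after the other.
  have hT : ∀ T : X →L[𝕜] lp (fun _ : ℕ => 𝕜) p, ‖T‖ ≤ 1 →
      RCLike.re (h T) ≤ ‖g + h‖ - ‖g‖ := fun T hT => by
    have := opNorm_le_of_forall_re_le (φ := g) (M := ‖g + h‖ - RCLike.re (h T)) fun S hS => by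
      linarith [key S T hS hT]
    linarith
  linarith [opNorm_le_of_forall_re_le hT]

theorem theorem3p7 {𝕜 X : Type*} [RCLike 𝕜] [NormedAddCommGroup X] [NormedSpace 𝕜 X]
    [CompleteSpace X] (p : ℝ≥0∞) [Fact (1 ≤ p)] (hp : 1 < p) (hp_top : p < ∞)
    (K : ℕ → X →L[𝕜] X) (hK : ∀ n, IsCompactOperator (K n))
    (ha : ∀ x : X, Tendsto (fun n => K n x) atTop (𝓝 x))
    (hb : ∀ f : StrongDual 𝕜 X, Tendsto (fun n => f.comp (K n)) atTop (𝓝 f))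
    (hc : Tendsto (fun n => ‖ContinuousLinearMap.id 𝕜 X - (2 : 𝕜) • K n‖) atTop (𝓝 1))
    (hineq : ∀ (x : X) (u : ℕ → X),
      Tendsto (fun n => toWeakSpace 𝕜 X (u n)) atTop (𝓝 0) →
      limsup (fun n => (‖x‖ ^ p.toReal + ‖u n‖ ^ p.toReal) ^ (1 / p.toReal)) atTop ≤
        limsup (fun n =>
          ((‖x + u n‖ ^ p.toReal + ‖x - u n‖ ^ p.toReal) / 2) ^ (1 / p.toReal)) atTop) :
    IsMIdeal (compactOperator (RingHom.id 𝕜) X (lp (fun _ : ℕ => 𝕜) p)) := by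
  obtain ⟨C, hC⟩ := exists_norm_le_of_tendsto_norm_id_sub_two_smul hc
  have hp0 : 0 < p.toReal := ENNReal.toReal_pos (zero_lt_one.trans hp).ne' hp_top.ne
  refine ⟨isClosed_setOfPred_isCompactOperator,
    recoveredFunctionals (lp (fun _ : ℕ => 𝕜) p) K (hyperfilter ℕ),
    isClosed_recoveredFunctionals hC,
    isCompl_topAnnihilator_recoveredFunctionals hC hK Nat.hyperfilter_le_atTop fun S hS => ?_,
    fun f hf g hg => le_antisymm (norm_add_le f g) ?_⟩
  · rw [tendsto_iff_norm_sub_tendsto_zero]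
    simpa [norm_sub_rev] using hS.tendsto_norm_comp_id_sub hC hb
  · refine norm_add_norm_le_of_eventually_rpow_add_rpow_le hp_top.ne hK Nat.hyperfilter_le_atTop
      (b := fun n => (1 + ‖ContinuousLinearMap.id 𝕜 X - (2 : 𝕜) • K n‖) / 2) ?_
      (fun n => by positivity)
      (fun n c hcn => eventually_rpow_add_rpow_le hp0 hK hb hc hineq n hcn) hf hg
    simpa [one_add_one_eq_two] using (hc.const_add 1).div_const 2
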